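/- Work over $\mathbb{C}$. Let $a,b\ge 1$ be integers and let $E=\mathcal{O}_{\mathbb{P}^1}(a)\oplus\mathcal{O}_{\mathbb{P}^1}(b)$ on $\mathbb{P}^1$. Let $$d_2:\textstyle\bigwedge^2H^0(\mathbb{P}^1,E)\longrightarrow H^0(\mathbb{P}^1,\textstyle\bigwedge^2E)=H^0(\mathbb{P}^1,\mathcal{O}_{\mathbb{P}^1}(a+b)),\qquad (s_1,s_2)\wedge(t_1,t_2)\longmapsto s_1t_2-t_1s_2,$$ be the determinant map, put $K^\perp=\ker(d_2)$, and let $\mathrm{Gr}_2(H^0(E))\subset\mathbb{P}(\bigwedge^2H^0(E))$ be the Grassmannian of two-dimensional subspaces of $H^0(E)$ in its Plücker embedding. Two smooth subvarieties $S_1,S_2$ of a projective space $\mathbb{P}^N$ are said to intersect transversely if $T_pS_1+T_pS_2=T_p\mathbb{P}^N$ for all $p\in S_1\cap S_2$. Then $\mathrm{Gr}_2(H^0(E))$ and $\mathbb{P}K^\perp$ intersect transversely if and only if $a=b=1$. Moreover, if $a=b=1$, then $\mathbb{P}K^\perp$ is a projective plane and $\mathbb{G}(E)=\mathrm{Gr}_2(H^0(E))\cap\mathbb{P}K^\perp$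 (with its reduced structure) is a smooth conic in it, that is, the zero locus of a nondegenerate quadratic form on the three-dimensional space $K^\perp$. -/

import Mathlib

open scoped LinearAlgebra.Projectivization

noncomputable section

namespace P1Bundle

/-! ### Line bundles on the projective line -/

/-- The standard grading of `ℂ[x₀, x₁]`. -/
abbrev grading : ℕ → Submodule ℂ (MvPolynomial (Fin 2) ℂ) :=
  MvPolynomial.homogeneousSubmodule (Fin 2) ℂ

instance gradingGraded : GradedAlgebra grading := MvPolynomial.gradedAlgebra

/-- The complex projective line `ℙ¹ = Proj ℂ[x₀, x₁]`, as a topological space. -/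
abbrev P1 : Type := ProjectiveSpectrum grading

/-- The localization of `ℂ[x₀, x₁]` at the homogeneous prime `x`; the stalk of `𝒪(d)` at `x` is
its homogeneous part of degree `d`. -/
abbrev Loc (x : P1) : Type := Localization.AtPrime x.asHomogeneousIdeal.toIdeal

/-- The family of germs `s` is, on the open set `V`, a fraction `f / g` of homogeneous polynomials
with `deg f - deg g = d`, the denominator `g` vanishing nowhere on `V`. -/
def IsFractionOn (d : ℤ) {U : TopologicalSpace.Opens P1} (s : ∀ x : U, Loc x.1)
    (V : TopologicalSpace.Opens P1) : Prop :=
  ∃ (i j : ℕ) (f g : MvPolynomial (Fin 2) ℂ), f ∈ grading i ∧ g ∈ grading j ∧ (i : ℤ) = j + d ∧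
    ∀ y : U, y.1 ∈ V → g ∉ y.1.asHomogeneousIdeal ∧
      s y * algebraMap (MvPolynomial (Fin 2) ℂ) (Loc y.1) g =
        algebraMap (MvPolynomial (Fin 2) ℂ) (Loc y.1) f

/-- A family of germs over `U` is a section of `𝒪(d)` if it is locally a fraction of degree `d`. -/
def IsSection (d : ℤ) {U : TopologicalSpace.Opens P1} (s : ∀ x : U, Loc x.1) : Prop :=
  ∀ x : U, ∃ V : TopologicalSpace.Opens P1, x.1 ∈ V ∧ IsFractionOn d s V

theorem exists_X_notMem (x : P1) :
    ∃ k : Fin 2, (MvPolynomial.X k : MvPolynomial (Fin 2) ℂ) ∉ x.asHomogeneousIdeal := by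
  by_contra! h
  apply x.not_irrelevant_le
  intro p hp
  have h0 : MvPolynomial.coeff 0 p = 0 := by
    have h1 : GradedRing.proj grading 0 p = 0 := (HomogeneousIdeal.mem_irrelevant_iff _ _).1 hp
    have h5 : GradedRing.proj grading 0 p = MvPolynomial.homogeneousComponent 0 p :=
      MvPolynomial.decomposition.decompose'_apply p 0
    rw [h5, MvPolynomial.homogeneousComponent_zero] at h1
    simpa using h1
  have h2 : p ∈ Ideal.span (MvPolynomial.X '' (Set.univ : Set (Fin 2))) := by
    rw [MvPolynomial.mem_ideal_span_X_image]
    intro m hm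
    by_contra! h3
    have : m = 0 := by ext k; simpa using h3 k (Set.mem_univ _)
    rw [this, MvPolynomial.mem_support_iff] at hm
    exact hm h0
  have h4 : Ideal.span (MvPolynomial.X '' (Set.univ : Set (Fin 2))) ≤
      x.asHomogeneousIdeal.toIdeal := by
    rw [Ideal.span_le]
    rintro _ ⟨k, -, rfl⟩
    exact h k
  exact h4 h2

theorem isSection_zero (d : ℤ) (U : TopologicalSpace.Opens P1) :
    IsSection d (0 : ∀ x : U, Loc x.1) := by
  intro x
  obtain ⟨k, hk⟩ := exists_X_notMem x.1
  refine ⟨ProjectiveSpectrum.basicOpen grading (MvPolynomial.X k), ?_, d.toNat, (-d).toNat, 0,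
    MvPolynomial.X k ^ (-d).toNat, Submodule.zero_mem _, ?_, by omega, ?_⟩
  · exact (ProjectiveSpectrum.mem_basicOpen _ _ _).2 hk
  · exact MvPolynomial.isHomogeneous_X_pow k _
  · intro y hy
    refine ⟨fun hmem => ?_, by simp⟩
    exact (ProjectiveSpectrum.mem_basicOpen _ _ _).1 hy (y.1.isPrime.mem_of_pow_mem _ hmem)

theorem IsSection.add {d : ℤ} {U : TopologicalSpace.Opens P1} {s t : ∀ x : U, Loc x.1}
    (hs : IsSection d s) (ht : IsSection d t) : IsSection d (s + t) := by
  intro x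
  obtain ⟨V, hxV, i, j, f, g, hf, hg, hij, h⟩ := hs x
  obtain ⟨V', hxV', i', j', f', g', hf', hg', hij', h'⟩ := ht x
  refine ⟨V ⊓ V', ⟨hxV, hxV'⟩, i + j', j + j', f * g' + f' * g, g * g', ?_, ?_, ?_, ?_⟩
  · refine Submodule.add_mem _ (MvPolynomial.IsHomogeneous.mul hf hg') ?_
    have : i + j' = i' + j := by omega
    rw [this]
    exact MvPolynomial.IsHomogeneous.mul hf' hg
  · exact MvPolynomial.IsHomogeneous.mul hg hg'
  · push_cast; omega
  · intro y hy
    obtain ⟨h1, h2⟩ := h y hy.1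
    obtain ⟨h1', h2'⟩ := h' y hy.2
    refine ⟨fun hm => (y.1.isPrime.mem_or_mem hm).elim h1 h1', ?_⟩
    simp only [Pi.add_apply, map_mul, map_add]
    rw [← h2, ← h2']
    ring

theorem IsSection.smul {d : ℤ} {U : TopologicalSpace.Opens P1} {s : ∀ x : U, Loc x.1}
    (c : ℂ) (hs : IsSection d s) : IsSection d (c • s) := by
  intro x
  obtain ⟨V, hxV, i, j, f, g, hf, hg, hij, h⟩ := hs x
  refine ⟨V, hxV, i, j, c • f, g, Submodule.smul_mem _ _ hf, hg, hij, fun y hy => ?_⟩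
  obtain ⟨h1, h2⟩ := h y hy
  refine ⟨h1, ?_⟩
  rw [Pi.smul_apply, smul_mul_assoc, h2, Algebra.smul_def, Algebra.smul_def, map_mul,
    ← IsScalarTower.algebraMap_apply]

theorem IsSection.mul {d e : ℤ} {U : TopologicalSpace.Opens P1} {s t : ∀ x : U, Loc x.1}
    (hs : IsSection d s) (ht : IsSection e t) : IsSection (d + e) (s * t) := by
  intro x
  obtain ⟨V, hxV, i, j, f, g, hf, hg, hij, h⟩ := hs x
  obtain ⟨V', hxV', i', j', f', g', hf', hg', hij', h'⟩ := ht x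
  refine ⟨V ⊓ V', ⟨hxV, hxV'⟩, i + i', j + j', f * f', g * g',
    MvPolynomial.IsHomogeneous.mul hf hf', MvPolynomial.IsHomogeneous.mul hg hg', ?_, ?_⟩
  · push_cast; omega
  · intro y hy
    obtain ⟨h1, h2⟩ := h y hy.1
    obtain ⟨h1', h2'⟩ := h' y hy.2
    refine ⟨fun hm => (y.1.isPrime.mem_or_mem hm).elim h1 h1', ?_⟩
    simp only [Pi.mul_apply, map_mul]
    rw [← h2, ← h2']
    ring

/-- The vector space `Γ(U, 𝒪(d))` of sections over `U` of the line bundle `𝒪(d)` on `ℙ¹`. -/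
def sections (d : ℤ) (U : TopologicalSpace.Opens P1) : Submodule ℂ (∀ x : U, Loc x.1) where
  carrier := {s | IsSection d s}
  add_mem' := IsSection.add
  zero_mem' := isSection_zero d U
  smul_mem' c _ := IsSection.smul c

/-- `H⁰(ℙ¹, 𝒪(d))`. -/
def H0 (d : ℤ) : Type := sections d ⊤

instance (d : ℤ) : AddCommGroup (H0 d) := inferInstanceAs (AddCommGroup (sections d ⊤))

instance (d : ℤ) : Module ℂ (H0 d) := inferInstanceAs (Module ℂ (sections d ⊤))

/-- `H⁰(ℙ¹, E)` for `E = 𝒪(a) ⊕ 𝒪(b)`. -/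
abbrev H0E (a b : ℤ) : Type := H0 a × H0 b

/-- The multiplication `H⁰(𝒪(a)) × H⁰(𝒪(b)) → H⁰(𝒪(a) ⊗ 𝒪(b)) = H⁰(𝒪(a + b))`. -/
def mulSections (a b : ℤ) : H0 a →ₗ[ℂ] H0 b →ₗ[ℂ] H0 (a + b) :=
  LinearMap.mk₂ ℂ (fun s t => ⟨s.1 * t.1, s.2.mul t.2⟩)
    (fun _ _ _ => Subtype.ext (add_mul _ _ _))
    (fun _ _ _ => Subtype.ext (smul_mul_assoc _ _ _))
    (fun _ _ _ => Subtype.ext (mul_add _ _ _))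
    (fun _ _ _ => Subtype.ext (mul_smul_comm _ _ _))

/-- The alternating map `((s₁, s₂), (t₁, t₂)) ↦ s₁ t₂ - t₁ s₂` on global sections of
`E = 𝒪(a) ⊕ 𝒪(b)`. -/
def detAlt (a b : ℤ) : H0E a b [⋀^Fin 2]→ₗ[ℂ] H0 (a + b) where
  toFun m := mulSections a b (m 0).1 (m 1).2 - mulSections a b (m 1).1 (m 0).2
  map_update_add' := by
    intro _ m i x y
    fin_cases i <;> simp <;> abel
  map_update_smul' := by
    intro _ m i c x
    fin_cases i <;> simp [smul_sub]
  map_eq_zero_of_eq' := by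
    intro m i j h hij
    have h01 : m 0 = m 1 := by
      fin_cases i <;> fin_cases j <;> simp_all
    simp [h01]

/-- The second determinant map `d₂ : ⋀² H⁰(E) → H⁰(⋀² E)` of `E = 𝒪(a) ⊕ 𝒪(b)`, where
`⋀² E = 𝒪(a) ⊗ 𝒪(b) = 𝒪(a + b)`. -/
def d₂ (a b : ℤ) : ⋀[ℂ]^2 (H0E a b) →ₗ[ℂ] H0 (a + b) :=
  exteriorPower.alternatingMapLinearEquiv (detAlt a b)

/-- The linear subspace `K^⊥ = ker d₂` of `⋀² H⁰(E)`. -/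
def Kperp (a b : ℤ) : Submodule ℂ (⋀[ℂ]^2 (H0E a b)) := LinearMap.ker (d₂ a b)

/-! ### Subvarieties of projective spaces and transversality -/

section Projective

variable {W : Type*} [AddCommGroup W] [Module ℂ W]

/-- The linear subvariety `ℙL` of `ℙW`. -/
def linearSubvariety (L : Submodule ℂ W) : Set (ℙ ℂ W) := {p | p.submodule ≤ L}

variable (W) in
/-- The Grassmannian `Gr₂(W)` of two-dimensional subspaces of `W` in its Plücker embedding in
`ℙ(⋀² W)`: the subspace with basis `s, t` corresponds to the line spanned by `s ∧ t`. -/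
def gr₂ : Set (ℙ ℂ (⋀[ℂ]^2 W)) :=
  {p | ∃ s t : W, LinearIndependent ℂ ![s, t] ∧
    p.submodule = Submodule.span ℂ {exteriorPower.ιMulti ℂ 2 ![s, t]}}

variable (W) in
/-- Polynomials in the linear forms on `W`. -/
abbrev Poly : Type _ := MvPolynomial (Module.Dual ℂ W) ℂ

/-- The value `F(w)`. -/
def Poly.value (w : W) : Poly W →ₐ[ℂ] ℂ := MvPolynomial.aeval fun φ : Module.Dual ℂ W => φ w

/-- The directional derivative `∂_v F`: the derivation that sends a linear form `φ` to the
constant `φ(v)`. -/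
def Poly.dirDeriv (v : W) : Derivation ℂ (Poly W) (Poly W) :=
  MvPolynomial.mkDerivation ℂ fun φ : Module.Dual ℂ W => MvPolynomial.C (φ v)

/-- `F` vanishes on (the affine cone over) the subset `S` of `ℙW`. -/
def Poly.VanishesOn (F : Poly W) (S : Set (ℙ ℂ W)) : Prop :=
  ∀ p ∈ S, ∀ w ∈ p.submodule, Poly.value w F = 0

theorem Poly.dirDeriv_add (v w : W) (F : Poly W) :
    Poly.dirDeriv (v + w) F = Poly.dirDeriv v F + Poly.dirDeriv w F := by
  have : Poly.dirDeriv (v + w) = Poly.dirDeriv v + Poly.dirDeriv w :=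
    MvPolynomial.derivation_ext fun φ => by simp [Poly.dirDeriv]
  rw [this]; rfl

theorem Poly.dirDeriv_smul (c : ℂ) (v : W) (F : Poly W) :
    Poly.dirDeriv (c • v) F = c • Poly.dirDeriv v F := by
  have : Poly.dirDeriv (c • v) = c • Poly.dirDeriv v :=
    MvPolynomial.derivation_ext fun φ => by
      simp [Poly.dirDeriv, MvPolynomial.smul_eq_C_mul]
  rw [this]; rfl

/-- The tangent space at the vector `w` to the affine cone over `S`: the common kernel of the
differentials at `w` of all polynomials vanishing on the cone. -/
def coneTangentSpace (S : Set (ℙ ℂ W)) (w : W) : Submodule ℂ W where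
  carrier := {v | ∀ F : Poly W, F.VanishesOn S → Poly.value w (Poly.dirDeriv v F) = 0}
  zero_mem' F _ := by
    have := Poly.dirDeriv_smul (0 : ℂ) (0 : W) F
    rw [zero_smul, zero_smul] at this
    rw [this, map_zero]
  add_mem' h h' F hF := by rw [Poly.dirDeriv_add, map_add, h F hF, h' F hF, add_zero]
  smul_mem' c v h F hF := by rw [Poly.dirDeriv_smul, map_smul, h F hF, smul_zero]

/-- The Zariski tangent space `T_p S` of a subvariety `S` of `ℙW` at a point `p = [w]` of `S`,
inside `T_p ℙW`, which is identified with `W / ⟨w⟩` by the choice of the representative `w`. -/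
def tangentSpace (S : Set (ℙ ℂ W)) (p : ℙ ℂ W) : Submodule ℂ (W ⧸ p.submodule) :=
  (coneTangentSpace S p.rep).map p.submodule.mkQ

/-- `S₁` and `S₂` intersect transversely: `T_p S₁ + T_p S₂ = T_p ℙW` for all `p ∈ S₁ ∩ S₂`. -/
def IntersectTransversely (S₁ S₂ : Set (ℙ ℂ W)) : Prop :=
  ∀ p ∈ S₁ ∩ S₂, tangentSpace S₁ p ⊔ tangentSpace S₂ p = ⊤

/-- `S` is a smooth conic in `ℙL`: `ℙL` is a projective plane, in which `S` is the zero locus of a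
nondegenerate quadratic form. -/
def IsSmoothConicIn (S : Set (ℙ ℂ W)) (L : Submodule ℂ W) : Prop :=
  Module.finrank ℂ L = 3 ∧ ∃ Q : QuadraticForm ℂ L, (QuadraticMap.polarBilin Q).Nondegenerate ∧
    S = {p | p ∈ linearSubvariety L ∧ ∀ w : L, (w : W) ∈ p.submodule → Q w = 0}

end Projective

/-- `𝔾(E) = Gr₂(H⁰(E)) ∩ ℙK^⊥` for `E = 𝒪(a) ⊕ 𝒪(b)`. -/
def GE (a b : ℤ) : Set (ℙ ℂ (⋀[ℂ]^2 (H0E a b))) :=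
  gr₂ (H0E a b) ∩ linearSubvariety (Kperp a b)

end P1Bundle

end

open scoped LinearAlgebra.Projectivization

noncomputable section

namespace P1Bundle

open MvPolynomial

/-! ### Global sections of `𝒪(d)` are homogeneous polynomials -/

/-! For `d ≥ 0`, global sections of `𝒪(d)` are the binary forms of degree `d`
(`exists_polynomial_of_isSection`), so `d₂` becomes a determinant of polynomials.

Suppose `a ≥ 2`; the case `b ≥ 2` is symmetric. The forms `x₀^a` and `x₀^(a-1) x₁` are independent
and vanish at `q = (0, 1)`. Placed in the first summand, they span a point of `𝔾(E)`. Let `α`, `β`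
be the values at `q` of the two components of a section of `E`. The form `α ∧ β` is `d₂` followed by
evaluation at `q`, so it kills `K^⊥`. Since `α` and `β` vanish on the chosen plane, a differentiated
Plücker relation shows that `α ∧ β` also kills the tangent space of the Grassmannian there. The two
tangent spaces thus lie in a common hyperplane (`not_intersectTransversely_gr₂`).

Suppose `a = b = 1`. On `K^⊥ ≅ ℂ³` the Plücker relation becomes `y₁² = y₀ y₂`, whose zeros are the
bivectors `σ₀ ∧ σ₁` with `σ_k = (α x_k, β x_k)`. As `d₂(σ_k ∧ u) = x_k (α u₂ - β u₁)`, and `α u₂ - β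
u₁` is an arbitrary linear form when `(α, β) ≠ 0`, the vectors `σ₀ ∧ u + σ₁ ∧ v` map onto all
quadratic forms. This gives transversality.

Tangency is proved by lines lying on the cone, and non-tangency by explicit equations. -/

theorem algebraMap_loc_injective (x : P1) :
    Function.Injective (algebraMap (MvPolynomial (Fin 2) ℂ) (Loc x)) :=
  IsLocalization.injective (Loc x) x.asHomogeneousIdeal.toIdeal.primeCompl_le_nonZeroDivisors

/-- The homogeneous core of the principal ideal of a prime element, as a point of `ℙ¹`. -/
theorem exists_point_of_le_prime (I : Ideal (MvPolynomial (Fin 2) ℂ)) (hI : I.IsPrime)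
    (k : Fin 2) (hk : (X k : MvPolynomial (Fin 2) ℂ) ∉ I) :
    ∃ x : P1, ∀ (j : ℕ) (g : MvPolynomial (Fin 2) ℂ), g ∈ grading j →
      (g ∈ x.asHomogeneousIdeal ↔ g ∈ I) := by
  refine ⟨⟨I.homogeneousCore grading, hI.homogeneousCore, fun h => hk ?_⟩, fun j g hg => ?_⟩
  · refine Ideal.toIdeal_homogeneousCore_le grading I (h ?_)
    refine (HomogeneousIdeal.mem_irrelevant_iff _ _).2 ?_
    exact DirectSum.decompose_of_mem_ne grading (isHomogeneous_X ℂ k) one_ne_zero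
  · exact ⟨fun h => Ideal.toIdeal_homogeneousCore_le grading I h,
      Ideal.mem_homogeneousCore_of_homogeneous_of_mem ⟨j, hg⟩⟩

/-- The generic point of `ℙ¹`. -/
theorem exists_generic_point : ∃ η : P1, ∀ V : TopologicalSpace.Opens P1, ∀ x ∈ V, η ∈ V := by
  have hp : (⊥ : HomogeneousIdeal grading).toIdeal.IsPrime := Ideal.isPrime_bot
  refine ⟨⟨⊥, hp, fun h => ?_⟩, fun V x hx => ?_⟩
  · have h0 : (X 0 : MvPolynomial (Fin 2) ℂ) ∈ (⊥ : HomogeneousIdeal grading) := by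
      refine h ((HomogeneousIdeal.mem_irrelevant_iff _ _).2 ?_)
      exact DirectSum.decompose_of_mem_ne grading (isHomogeneous_X ℂ 0) one_ne_zero
    exact X_ne_zero (R := ℂ) (0 : Fin 2) (Ideal.mem_bot.1 h0)
  · obtain ⟨s, hs⟩ := (ProjectiveSpectrum.isOpen_iff _ _).1 V.2
    by_contra hη
    have h1 : (⟨⊥, hp, _⟩ : P1) ∈ (V : Set P1)ᶜ := hη
    have h2 : x ∈ (V : Set P1)ᶜ := by
      have hs' : (V : Set P1)ᶜ = ProjectiveSpectrum.zeroLocus grading s := hs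
      rw [hs'] at h1 ⊢
      intro f hf
      have : f ∈ (⊥ : HomogeneousIdeal grading) := h1 hf
      have : f = 0 := Ideal.mem_bot.1 this
      rw [this]
      exact Submodule.zero_mem _
    exact h2 hx

/-- The component of `F * g` in degree `n + j` is `F_n * g`; cancelling `g` gives `F = F_n`. -/
theorem isHomogeneous_of_mul {i j n : ℕ} {F f g : MvPolynomial (Fin 2) ℂ} (hf : f ∈ grading i)
    (hg : g ∈ grading j) (hg0 : g ≠ 0) (hij : i = n + j) (h : F * g = f) : F ∈ grading n := by
  have h1 := DirectSum.coe_decompose_mul_add_of_right_mem grading (a := F) (i := n) hg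
  rw [h, ← hij, DirectSum.decompose_of_mem_same grading hf, ← h] at h1
  rw [mul_right_cancel₀ hg0 h1]
  exact SetLike.coe_mem _

/-- All local fractions agree at the generic point, so the section is one reduced fraction. A prime
factor of its denominator would give a point where the section is not regular. -/
theorem exists_polynomial_of_isSection {d : ℤ} {s : ∀ x : (⊤ : TopologicalSpace.Opens P1), Loc x.1}
    (hs : IsSection d s) : ∃ F : MvPolynomial (Fin 2) ℂ, (0 ≤ d → F ∈ grading d.toNat) ∧
      ∀ x, s x = algebraMap _ (Loc x.1) F := by
  obtain ⟨η, hη⟩ := exists_generic_point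
  choose V hxV i j f g hf hg hij h using hs
  have key (x : (⊤ : TopologicalSpace.Opens P1)) :
      s ⟨η, trivial⟩ * algebraMap _ (Loc η) (g x) = algebraMap _ (Loc η) (f x) :=
    (h x ⟨η, trivial⟩ (hη _ _ (hxV x))).2
  have hgx (x : (⊤ : TopologicalSpace.Opens P1)) : g x ∉ x.1.asHomogeneousIdeal :=
    (h x x (hxV x)).1
  have hg0 (x : (⊤ : TopologicalSpace.Opens P1)) : g x ≠ 0 := fun h0 =>
    hgx x (by rw [h0]; exact Submodule.zero_mem _)
  obtain ⟨f', g', c, hrel, hcf, hcg⟩ := UniqueFactorizationMonoid.exists_reduced_factors'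
    (f ⟨η, trivial⟩) (g ⟨η, trivial⟩) (hg0 _)
  have hc : c ≠ 0 := by
    rintro rfl
    exact hg0 ⟨η, trivial⟩ (by rw [← hcg, zero_mul])
  have cross (x : (⊤ : TopologicalSpace.Opens P1)) : f' * g x = f x * g' := by
    have h1 : f ⟨η, trivial⟩ * g x = f x * g ⟨η, trivial⟩ := by
      apply algebraMap_loc_injective η
      rw [map_mul, map_mul, ← key, ← key]
      ring
    rw [← hcf, ← hcg] at h1
    apply mul_left_cancel₀ hc
    linear_combination h1
  -- An irreducible factor `q` of `g'` need not be known to be homogeneous: the homogeneous core of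
  -- `(q)` is a point `x`, and the homogeneous `g x` avoids it exactly when `q ∤ g x`. Then `cross`
  -- forces `q ∣ f'`, contradicting reducedness.
  have hunit : IsUnit g' := by
    by_contra hnu
    have hg'0 : g' ≠ 0 := by
      rintro rfl
      exact hg0 ⟨η, trivial⟩ (by rw [← hcg, mul_zero])
    obtain ⟨q, hq, hqg⟩ := WfDvdMonoid.exists_irreducible_factor hnu hg'0
    have hqp : Prime q := hq.prime
    -- An irreducible dividing both variables would make them associated; this keeps the core from
    -- containing the irrelevant ideal.
    have hX : ∃ k : Fin 2, (X k : MvPolynomial (Fin 2) ℂ) ∉ Ideal.span {q} := by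
      by_contra! hall
      have h0 := Ideal.mem_span_singleton.1 (hall 0)
      have h1 := Ideal.mem_span_singleton.1 (hall 1)
      have h2 : (X 0 : MvPolynomial (Fin 2) ℂ) ∣ X 1 :=
        ((hq.dvd_irreducible_iff_associated (X_prime (i := 0)).irreducible).1 h0).symm.dvd.trans h1
      rw [X_dvd_X] at h2
      simp at h2
    obtain ⟨k, hk⟩ := hX
    obtain ⟨x, hx⟩ := exists_point_of_le_prime (Ideal.span {q})
      ((Ideal.span_singleton_prime hqp.ne_zero).2 hqp) k hk
    have h1 : ¬ q ∣ g ⟨x, trivial⟩ := fun hd =>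
      hgx ⟨x, trivial⟩ ((hx _ _ (hg _)).2 (Ideal.mem_span_singleton.2 hd))
    have h2 : q ∣ f' * g ⟨x, trivial⟩ := by
      rw [cross]
      exact hqg.mul_left _
    exact hq.not_isUnit (hrel ((hqp.dvd_or_dvd h2).resolve_right h1) hqg)
  obtain ⟨u, hu⟩ := hunit.exists_right_inv
  have hF (x : (⊤ : TopologicalSpace.Opens P1)) : f' * u * g x = f x := by
    linear_combination u * cross x + f x * hu
  refine ⟨f' * u, fun hd => ?_, fun x => ?_⟩
  · have := hij ⟨η, trivial⟩
    exact isHomogeneous_of_mul (hf ⟨η, trivial⟩) (hg ⟨η, trivial⟩) (hg0 _) (by omega) (hF _)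
  · have hu : IsUnit (algebraMap _ (Loc x.1) (g x)) :=
      IsLocalization.map_units (Loc x.1)
        (⟨g x, hgx x⟩ : x.1.asHomogeneousIdeal.toIdeal.primeCompl)
    apply hu.mul_right_cancel
    rw [(h x x (hxV x)).2, ← map_mul, hF]

/-- A polynomial as a family of germs. -/
def germs : MvPolynomial (Fin 2) ℂ →ₗ[ℂ] ∀ x : (⊤ : TopologicalSpace.Opens P1), Loc x.1 :=
  LinearMap.pi fun x => (IsScalarTower.toAlgHom ℂ (MvPolynomial (Fin 2) ℂ) (Loc x.1)).toLinearMap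

theorem germs_apply (F : MvPolynomial (Fin 2) ℂ) (x : (⊤ : TopologicalSpace.Opens P1)) :
    germs F x = algebraMap _ (Loc x.1) F := rfl

theorem germs_injective : Function.Injective germs := by
  intro F G h
  obtain ⟨η, -⟩ := exists_generic_point
  exact algebraMap_loc_injective η (congrFun h ⟨η, trivial⟩)

theorem isSection_germs {d : ℤ} (hd : 0 ≤ d) {F : MvPolynomial (Fin 2) ℂ}
    (hF : F ∈ grading d.toNat) : IsSection d (germs F) := fun _ =>
  ⟨⊤, trivial, d.toNat, 0, F, 1, hF, isHomogeneous_one _ _, by omega, fun y _ =>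
    ⟨fun h => y.1.isPrime.ne_top ((Ideal.eq_top_iff_one _).2 h), by rw [map_one, mul_one]; rfl⟩⟩

/-- The polynomial that represents a global section of `𝒪(d)`. -/
def toPoly (d : ℤ) : H0 d →ₗ[ℂ] MvPolynomial (Fin 2) ℂ :=
  (LinearEquiv.ofInjective germs germs_injective).symm.toLinearMap ∘ₗ
    Submodule.inclusion (p := sections d ⊤) (p' := LinearMap.range germs) (fun s hs => by
      obtain ⟨F, -, h⟩ := exists_polynomial_of_isSection hs
      exact ⟨F, (funext h).symm⟩)

theorem germs_toPoly {d : ℤ} (s : H0 d) : germs (toPoly d s) = s.1 :=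
  congrArg Subtype.val ((LinearEquiv.ofInjective germs germs_injective).apply_symm_apply _)

theorem toPoly_injective (d : ℤ) : Function.Injective (toPoly d) := by
  intro s t h
  exact Subtype.ext (by rw [← germs_toPoly, ← germs_toPoly, h])

theorem toPoly_mem {d : ℤ} (hd : 0 ≤ d) (s : H0 d) : toPoly d s ∈ grading d.toNat := by
  obtain ⟨F, hF, h⟩ := exists_polynomial_of_isSection s.2
  have : toPoly d s = F := germs_injective ((germs_toPoly s).trans (funext h))
  rw [this]
  exact hF hd

/-- The global section of `𝒪(d)` given by a homogeneous polynomial of degree `d`. -/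
def ofPoly {d : ℤ} (hd : 0 ≤ d) (F : MvPolynomial (Fin 2) ℂ) (hF : F ∈ grading d.toNat) : H0 d :=
  ⟨germs F, isSection_germs hd hF⟩

theorem toPoly_ofPoly {d : ℤ} (hd : 0 ≤ d) (F : MvPolynomial (Fin 2) ℂ)
    (hF : F ∈ grading d.toNat) : toPoly d (ofPoly hd F hF) = F :=
  germs_injective (germs_toPoly _)

theorem toPoly_mulSections {a b : ℤ} (s : H0 a) (t : H0 b) :
    toPoly (a + b) (mulSections a b s t) = toPoly a s * toPoly b t := by
  apply germs_injective
  rw [germs_toPoly]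
  funext x
  rw [germs_apply, map_mul, ← germs_apply, ← germs_apply, germs_toPoly, germs_toPoly]
  rfl

/-! ### Exterior squares and the Plücker relation. -/

theorem update_pair_zero {V : Type*} (s t u : V) : Function.update ![s, t] 0 u = ![u, t] := by
  ext i
  fin_cases i <;> simp

theorem update_pair_one {V : Type*} (s t u : V) : Function.update ![s, t] 1 u = ![s, u] := by
  ext i
  fin_cases i <;> simp

section ExteriorSquare

variable {V : Type*} [AddCommGroup V] [Module ℂ V]

/-- The alternating bilinear map `(s, t) ↦ s ∧ t`. -/
def wedge : V →ₗ[ℂ] V →ₗ[ℂ] ⋀[ℂ]^2 V :=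
  LinearMap.mk₂ ℂ (fun s t => exteriorPower.ιMulti ℂ 2 ![s, t])
    (fun s s' t => by simpa only [update_pair_zero, update_pair_one] using
      (exteriorPower.ιMulti ℂ 2).map_update_add ![s, t] 0 s s')
    (fun c s t => by simpa only [update_pair_zero, update_pair_one] using
      (exteriorPower.ιMulti ℂ 2).map_update_smul ![s, t] 0 c s)
    (fun s t t' => by simpa only [update_pair_zero, update_pair_one] using
      (exteriorPower.ιMulti ℂ 2).map_update_add ![s, t] 1 t t')
    (fun c s t => by simpa only [update_pair_zero, update_pair_one] using
      (exteriorPower.ιMulti ℂ 2).map_update_smul ![s, t] 1 c t)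

theorem wedge_apply (s t : V) : wedge s t = exteriorPower.ιMulti ℂ 2 ![s, t] := rfl

@[simp]
theorem wedge_self (s : V) : wedge s s = 0 :=
  (exteriorPower.ιMulti ℂ 2).map_eq_zero_of_eq ![s, s] (i := 0) (j := 1) rfl zero_ne_one

theorem wedge_swap (s t : V) : wedge t s = -wedge s t := by
  have h := wedge_self (s + t)
  simp only [map_add, LinearMap.add_apply, wedge_self, zero_add, add_zero] at h
  exact eq_neg_of_add_eq_zero_left h

theorem linearIndependent_of_wedge_ne_zero {s t : V} (h : wedge s t ≠ 0) :
    LinearIndependent ℂ ![s, t] := by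
  by_contra hn
  exact h ((exteriorPower.ιMulti ℂ 2).map_linearDependent _ hn)

theorem linearMap_ext_wedge {N : Type*} [AddCommGroup N] [Module ℂ N] {f g : ⋀[ℂ]^2 V →ₗ[ℂ] N}
    (h : ∀ s t, f (wedge s t) = g (wedge s t)) : f = g := by
  apply exteriorPower.linearMap_ext
  ext m
  have hm : m = ![m 0, m 1] := by ext i; fin_cases i <;> rfl
  rw [LinearMap.compAlternatingMap_apply, LinearMap.compAlternatingMap_apply, hm]
  exact h _ _

/-- The linear form `s ∧ t ↦ α(s) β(t) - α(t) β(s)` on `⋀² V`. -/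
def wedgeForm (α β : Module.Dual ℂ V) : Module.Dual ℂ (⋀[ℂ]^2 V) :=
  exteriorPower.alternatingMapLinearEquiv
    { toFun := fun m => α (m 0) * β (m 1) - α (m 1) * β (m 0)
      map_update_add' := by
        intro _ m i x y
        fin_cases i <;> simp <;> ring
      map_update_smul' := by
        intro _ m i c x
        fin_cases i <;> simp <;> ring
      map_eq_zero_of_eq' := by
        intro m i j h hij
        have h01 : m 0 = m 1 := by
          fin_cases i <;> fin_cases j <;> simp_all
        rw [h01, sub_self] }

@[simp]
theorem wedgeForm_wedge (α β : Module.Dual ℂ V) (s t : V) :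
    wedgeForm α β (wedge s t) = α s * β t - α t * β s :=
  exteriorPower.alternatingMapLinearEquiv_apply_ιMulti _ _

/-- The three-term identity between the 2×2 minors of a 2×4 matrix. It supplies the quadrics through
the Grassmannian used both for its tangent spaces and for the conic. -/
theorem plucker_relation (α β γ δ : Module.Dual ℂ V) (s t : V) :
    wedgeForm γ δ (wedge s t) * wedgeForm α β (wedge s t) -
      wedgeForm γ α (wedge s t) * wedgeForm δ β (wedge s t) +
      wedgeForm γ β (wedge s t) * wedgeForm δ α (wedge s t) = 0 := by
  simp only [wedgeForm_wedge]
  ring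

theorem mk_wedge_mem_gr₂ {s t : V} (h : wedge s t ≠ 0) :
    Projectivization.mk ℂ (wedge s t) h ∈ gr₂ V :=
  ⟨s, t, linearIndependent_of_wedge_ne_zero h, Projectivization.submodule_mk _ _⟩

theorem exists_eq_wedge_of_mem_gr₂ {p : ℙ ℂ (⋀[ℂ]^2 V)} (hp : p ∈ gr₂ V) {w : ⋀[ℂ]^2 V}
    (hw : w ∈ p.submodule) : ∃ s t : V, w = wedge s t := by
  obtain ⟨s, t, -, h⟩ := hp
  rw [h, Submodule.mem_span_singleton] at hw
  obtain ⟨c, rfl⟩ := hw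
  exact ⟨c • s, t, by rw [map_smul, LinearMap.smul_apply, wedge_apply]⟩

end ExteriorSquare

/-! ### Tangent spaces of cones and of linear subvarieties. -/

section Tangent

variable {W : Type*} [AddCommGroup W] [Module ℂ W]

theorem rep_mem_submodule (p : ℙ ℂ W) : p.rep ∈ p.submodule := by
  rw [p.submodule_eq]
  exact Submodule.mem_span_singleton_self _

theorem tangentSpace_sup_eq_top_iff (S₁ S₂ : Set (ℙ ℂ W)) (p : ℙ ℂ W) :
    tangentSpace S₁ p ⊔ tangentSpace S₂ p = ⊤ ↔
      p.submodule ⊔ (coneTangentSpace S₁ p.rep ⊔ coneTangentSpace S₂ p.rep) = ⊤ := by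
  rw [tangentSpace, tangentSpace, ← Submodule.map_sup, Submodule.map_mkQ_eq_top]

theorem value_X (w : W) (φ : Module.Dual ℂ W) : Poly.value w (X φ) = φ w :=
  aeval_X _ _

theorem dirDeriv_X (v : W) (φ : Module.Dual ℂ W) : Poly.dirDeriv v (X φ) = C (φ v) :=
  mkDerivation_X _ _ _

/-- If the line through `w` in direction `v` lies on the cone over `S`, then `v` is tangent. -/
theorem mem_coneTangentSpace_of_line {S : Set (ℙ ℂ W)} {w v : W}
    (h : ∀ c : ℂ, ∃ p ∈ S, w + c • v ∈ p.submodule) : v ∈ coneTangentSpace S w := by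
  intro F hF
  -- Restriction to the line `c ↦ w + c • v`; its derivative at `0` is the directional derivative,
  -- and a polynomial vanishing at every `c` is zero.
  let Φ : Poly W →ₐ[ℂ] Polynomial ℂ :=
    aeval fun φ : Module.Dual ℂ W => Polynomial.C (φ w) + Polynomial.X * Polynomial.C (φ v)
  have h1 (c : ℂ) (G : Poly W) : (Φ G).eval c = Poly.value (w + c • v) G := by
    have : (Polynomial.aeval c).comp Φ = Poly.value (w + c • v) := by
      ext φ
      simp [Φ, value_X, mul_comm c]
    rw [← this]
    simp [Polynomial.coe_aeval_eq_eval]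
  have h1' (G : Poly W) : (Φ G).eval 0 = Poly.value w G := by
    rw [h1, zero_smul, add_zero]
  have h2 (G : Poly W) : (Φ G).derivative.eval 0 = Poly.value w (Poly.dirDeriv v G) := by
    induction G using MvPolynomial.induction_on with
    | C a => simp [Φ, Poly.dirDeriv]
    | add p q hp hq => simp only [map_add, Polynomial.eval_add, hp, hq]
    | mul_X p φ hp =>
      rw [map_mul, Polynomial.derivative_mul, Derivation.leibniz, dirDeriv_X]
      have hX : (Φ (X φ)).derivative.eval 0 = φ v := by simp [Φ]
      have hC : Poly.value w (C (φ v)) = φ v := aeval_C _ _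
      rw [Polynomial.eval_add, Polynomial.eval_mul, Polynomial.eval_mul, hp, h1', h1', hX,
        map_add, smul_eq_mul, smul_eq_mul, map_mul, map_mul, hC, value_X]
      ring
  have h3 : Φ F = 0 := by
    refine Polynomial.funext fun c => ?_
    obtain ⟨p, hp, hw⟩ := h c
    rw [h1, Polynomial.eval_zero]
    exact hF p hp _ hw
  rw [← h2, h3, Polynomial.derivative_zero, Polynomial.eval_zero]

theorem le_coneTangentSpace_linearSubvariety {L : Submodule ℂ W} {w : W} (hw : w ∈ L)
    (hw0 : w ≠ 0) : L ≤ coneTangentSpace (linearSubvariety L) w := by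
  intro v hv
  refine mem_coneTangentSpace_of_line fun c => ?_
  have hmem {u : W} (hu : u ∈ L) (hu0 : u ≠ 0) :
      Projectivization.mk ℂ u hu0 ∈ linearSubvariety L := by
    change Projectivization.submodule _ ≤ L
    rw [Projectivization.submodule_mk, Submodule.span_singleton_le_iff_mem]
    exact hu
  -- The zero vector defines no projective point, but it lies on the line `[w]`.
  by_cases h0 : w + c • v = 0
  · exact ⟨_, hmem hw hw0, by rw [h0]; exact Submodule.zero_mem _⟩
  · refine ⟨_, hmem (L.add_mem hw (L.smul_mem c hv)) h0, ?_⟩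
    rw [Projectivization.submodule_mk]
    exact Submodule.mem_span_singleton_self _

theorem apply_eq_zero_of_mem_coneTangentSpace_linearSubvariety {L : Submodule ℂ W}
    {φ : Module.Dual ℂ W} (hφ : ∀ u ∈ L, φ u = 0) {w v : W}
    (hv : v ∈ coneTangentSpace (linearSubvariety L) w) : φ v = 0 := by
  have h := hv (X φ) fun p hp u hu => by rw [value_X]; exact hφ u (hp hu)
  simpa [dirDeriv_X, Poly.value] using h

end Tangent

/-! ### Tangent vectors of the Grassmannian and the obstruction to transversality. -/

section GrassmannianTangent

variable {V : Type*} [AddCommGroup V] [Module ℂ V]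

/-- The line `s ∧ (t + c v)` consists of decomposable bivectors. -/
theorem wedge_mem_coneTangentSpace_gr₂ {s t : V} (h : wedge s t ≠ 0) (v : V) :
    wedge s v ∈ coneTangentSpace (gr₂ V) (wedge s t) := by
  refine mem_coneTangentSpace_of_line fun c => ?_
  rw [← map_smul, ← map_add]
  by_cases h0 : wedge s (t + c • v) = 0
  · exact ⟨_, mk_wedge_mem_gr₂ h, by rw [h0]; exact Submodule.zero_mem _⟩
  · refine ⟨_, mk_wedge_mem_gr₂ h0, ?_⟩
    rw [Projectivization.submodule_mk]
    exact Submodule.mem_span_singleton_self _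

theorem wedge_mem_coneTangentSpace_gr₂' {s t : V} (h : wedge s t ≠ 0) (v : V) :
    wedge t v ∈ coneTangentSpace (gr₂ V) (wedge s t) := by
  refine mem_coneTangentSpace_of_line fun c => ?_
  have h1 : wedge s t + c • wedge t v = wedge (s - c • v) t := by
    rw [wedge_swap v t, map_sub, map_smul, LinearMap.sub_apply, LinearMap.smul_apply]
    module
  rw [h1]
  by_cases h0 : wedge (s - c • v) t = 0
  · exact ⟨_, mk_wedge_mem_gr₂ h, by rw [h0]; exact Submodule.zero_mem _⟩
  · refine ⟨_, mk_wedge_mem_gr₂ h0, ?_⟩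
    rw [Projectivization.submodule_mk]
    exact Submodule.mem_span_singleton_self _

/-- A product of two linear forms that vanish on the plane `⟨s, t⟩` vanishes on the tangent space
of the Grassmannian at `s ∧ t`. -/
theorem wedgeForm_eq_zero_of_mem_coneTangentSpace_gr₂ {α β γ δ : Module.Dual ℂ V} {s t : V}
    (hαs : α s = 0) (hαt : α t = 0) (hβs : β s = 0) (hβt : β t = 0)
    (hne : γ s * δ t - γ t * δ s ≠ 0) {c : ℂ} (hc : c ≠ 0) {v : ⋀[ℂ]^2 V}
    (hv : v ∈ coneTangentSpace (gr₂ V) (c • wedge s t)) : wedgeForm α β v = 0 := by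
  -- At a multiple of `s ∧ t`, every form involving `α` or `β` vanishes, so differentiating leaves
  -- only `c (γ ∧ δ)(s ∧ t) · (α ∧ β)(v)`.
  have h := hv (X (wedgeForm γ δ) * X (wedgeForm α β) - X (wedgeForm γ α) * X (wedgeForm δ β) +
    X (wedgeForm γ β) * X (wedgeForm δ α)) fun p hp w hw => by
      obtain ⟨s, t, rfl⟩ := exists_eq_wedge_of_mem_gr₂ hp hw
      simp only [map_add, map_sub, map_mul, value_X]
      exact plucker_relation α β γ δ s t
  simp only [map_add, map_sub, map_mul, Derivation.leibniz, dirDeriv_X, smul_eq_mul, value_X,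
    map_smul, wedgeForm_wedge, hαs, hαt, hβs, hβt] at h
  simpa [Poly.value, hc, hne] using h

/-- The hyperplane `α ∧ β = 0` contains the point and both tangent spaces; `γ` and `δ` certify that
`s ∧ t ≠ 0`. -/
theorem not_intersectTransversely_gr₂ {L : Submodule ℂ (⋀[ℂ]^2 V)} {α β γ δ : Module.Dual ℂ V}
    {s t : V} (hL : ∀ w ∈ L, wedgeForm α β w = 0) (hst : wedge s t ∈ L)
    (hαs : α s = 0) (hαt : α t = 0) (hβs : β s = 0) (hβt : β t = 0)
    (hne : γ s * δ t - γ t * δ s ≠ 0) (h0 : wedgeForm α β ≠ 0) :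
    ¬ IntersectTransversely (gr₂ V) (linearSubvariety L) := by
  intro htr
  have hw : wedge s t ≠ 0 := by
    intro hw
    apply hne
    rw [← wedgeForm_wedge, hw, map_zero]
  have hp := htr (Projectivization.mk ℂ _ hw) ⟨mk_wedge_mem_gr₂ hw, by
    change Projectivization.submodule _ ≤ L
    rw [Projectivization.submodule_mk, Submodule.span_singleton_le_iff_mem]
    exact hst⟩
  obtain ⟨c, hc⟩ := Projectivization.exists_smul_eq_mk_rep ℂ _ hw
  rw [tangentSpace_sup_eq_top_iff, ← hc, Projectivization.submodule_mk] at hp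
  apply h0
  rw [← LinearMap.ker_eq_top, eq_top_iff, ← hp]
  refine sup_le ?_ (sup_le ?_ ?_)
  · rw [Submodule.span_singleton_le_iff_mem]
    exact hL _ hst
  · intro v hv
    exact wedgeForm_eq_zero_of_mem_coneTangentSpace_gr₂ hαs hαt hβs hβt hne c.ne_zero hv
  · intro v hv
    exact apply_eq_zero_of_mem_coneTangentSpace_linearSubvariety hL hv

end GrassmannianTangent

/-! ### The determinant map on polynomials, and failure of transversality in degree at least two. -/

section Determinant

variable {a b : ℤ}

theorem d₂_wedge (s t : H0E a b) :
    d₂ a b (wedge s t) = mulSections a b s.1 t.2 - mulSections a b t.1 s.2 :=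
  exteriorPower.alternatingMapLinearEquiv_apply_ιMulti _ _

theorem toPoly_d₂_wedge (s t : H0E a b) : toPoly (a + b) (d₂ a b (wedge s t)) =
    toPoly a s.1 * toPoly b t.2 - toPoly a t.1 * toPoly b s.2 := by
  rw [d₂_wedge, map_sub, toPoly_mulSections, toPoly_mulSections]

theorem mem_Kperp_iff (w : ⋀[ℂ]^2 (H0E a b)) :
    w ∈ Kperp a b ↔ toPoly (a + b) (d₂ a b w) = 0 := by
  rw [Kperp, LinearMap.mem_ker, map_eq_zero_iff _ (toPoly_injective _)]

/-- The value of a section of `𝒪(d)` at the point `(0, 1)`. -/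
def valueAt (d : ℤ) : Module.Dual ℂ (H0 d) :=
  (aeval (R := ℂ) ![(0 : ℂ), 1]).toLinearMap ∘ₗ toPoly d

theorem valueAt_apply (d : ℤ) (s : H0 d) : valueAt d s = aeval ![(0 : ℂ), 1] (toPoly d s) := rfl

/-- Evaluation at a point is multiplicative, so this form factors through `d₂`. -/
theorem wedgeForm_valueAt_eq_zero {w : ⋀[ℂ]^2 (H0E a b)} (hw : w ∈ Kperp a b) :
    wedgeForm (valueAt a ∘ₗ LinearMap.fst ℂ _ _) (valueAt b ∘ₗ LinearMap.snd ℂ _ _) w = 0 := by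
  have h : wedgeForm (valueAt a ∘ₗ LinearMap.fst ℂ _ _) (valueAt b ∘ₗ LinearMap.snd ℂ _ _) =
      valueAt (a + b) ∘ₗ d₂ a b := by
    refine linearMap_ext_wedge fun s t => ?_
    rw [LinearMap.comp_apply, valueAt_apply, toPoly_d₂_wedge, wedgeForm_wedge]
    simp [valueAt_apply]
  rw [h, LinearMap.comp_apply, LinearMap.mem_ker.1 hw, map_zero]

theorem exists_section_valueAt_ne_zero {d : ℤ} (hd : 0 ≤ d) : ∃ s : H0 d, valueAt d s ≠ 0 := by
  have h : X 1 ^ d.toNat ∈ grading d.toNat := isHomogeneous_X_pow _ _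
  refine ⟨ofPoly hd _ h, ?_⟩
  rw [valueAt_apply, toPoly_ofPoly]
  simp

theorem wedgeForm_valueAt_ne_zero (ha : 0 ≤ a) (hb : 0 ≤ b) :
    wedgeForm (valueAt a ∘ₗ LinearMap.fst ℂ (H0 a) (H0 b))
      (valueAt b ∘ₗ LinearMap.snd ℂ (H0 a) (H0 b)) ≠ 0 := by
  obtain ⟨s, hs⟩ := exists_section_valueAt_ne_zero ha
  obtain ⟨t, ht⟩ := exists_section_valueAt_ne_zero hb
  intro h
  have := LinearMap.congr_fun h (wedge (s, 0) (0, t))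
  simp [hs, ht] at this

/-- The sections `x₀^d` and `x₀^(d-1) x₁` of `𝒪(d)` for `d ≥ 2`. -/
theorem exists_sections_vanishing {d : ℤ} (hd : 2 ≤ d) :
    ∃ (s t : H0 d) (γ δ : Module.Dual ℂ (H0 d)), valueAt d s = 0 ∧ valueAt d t = 0 ∧
      γ s * δ t - γ t * δ s ≠ 0 := by
  obtain ⟨n, rfl⟩ : ∃ n : ℕ, d = n + 2 := ⟨(d - 2).toNat, by omega⟩
  have hn : ((n : ℤ) + 2).toNat = n + 2 := by omega
  have hd' : (0 : ℤ) ≤ n + 2 := by omega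
  let s : H0 ((n : ℤ) + 2) := ofPoly hd' (X 0 ^ (n + 2))
    (by rw [hn]; exact isHomogeneous_X_pow _ _)
  let t : H0 ((n : ℤ) + 2) := ofPoly hd' (X 0 ^ (n + 1) * X 1)
    (by rw [hn]; exact (isHomogeneous_X_pow _ _).mul (isHomogeneous_X _ _))
  have hs : toPoly _ s = X 0 ^ (n + 2) := toPoly_ofPoly _ _ _
  have ht : toPoly _ t = X 0 ^ (n + 1) * X 1 := toPoly_ofPoly _ _ _
  -- Evaluating at `(1, 0)` and `(1, 1)` gives `s` the values `1, 1` and `t` the values `0, 1`: the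
  -- determinant is `1`.
  refine ⟨s, t, (aeval (R := ℂ) ![(1 : ℂ), 0]).toLinearMap ∘ₗ toPoly _,
    (aeval (R := ℂ) ![(1 : ℂ), 1]).toLinearMap ∘ₗ toPoly _, ?_, ?_, ?_⟩
  · rw [valueAt_apply, hs]; simp
  · rw [valueAt_apply, ht]; simp
  · simp [hs, ht]

theorem not_intersectTransversely_of_left (ha : 2 ≤ a) (hb : 1 ≤ b) :
    ¬ IntersectTransversely (gr₂ (H0E a b)) (linearSubvariety (Kperp a b)) := by
  obtain ⟨s, t, γ, δ, hs, ht, hne⟩ := exists_sections_vanishing ha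
  refine not_intersectTransversely_gr₂ (s := (s, 0)) (t := (t, 0))
    (γ := γ ∘ₗ LinearMap.fst ℂ _ _) (δ := δ ∘ₗ LinearMap.fst ℂ _ _)
    (fun w hw => wedgeForm_valueAt_eq_zero hw) ?_ hs ht
    (map_zero (valueAt b)) (map_zero (valueAt b)) hne
    (wedgeForm_valueAt_ne_zero (by omega) (by omega))
  rw [mem_Kperp_iff, toPoly_d₂_wedge]
  simp

theorem not_intersectTransversely_of_right (ha : 1 ≤ a) (hb : 2 ≤ b) :
    ¬ IntersectTransversely (gr₂ (H0E a b)) (linearSubvariety (Kperp a b)) := by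
  obtain ⟨s, t, γ, δ, hs, ht, hne⟩ := exists_sections_vanishing hb
  refine not_intersectTransversely_gr₂ (s := (0, s)) (t := (0, t))
    (γ := γ ∘ₗ LinearMap.snd ℂ _ _) (δ := δ ∘ₗ LinearMap.snd ℂ _ _)
    (fun w hw => wedgeForm_valueAt_eq_zero hw) ?_ (map_zero (valueAt a))
    (map_zero (valueAt a)) hs ht hne
    (wedgeForm_valueAt_ne_zero (by omega) (by omega))
  rw [mem_Kperp_iff, toPoly_d₂_wedge]
  simp

end Determinant

/-! ### A nondegenerate conic in coordinates. -/

section Conic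

variable {W : Type*} [AddCommGroup W] [Module ℂ W] {L : Submodule ℂ W}

/-- The quadratic form `y₁² - y₀ y₂` in linear coordinates `y` on `L`. -/
def conic (e : L ≃ₗ[ℂ] (Fin 3 → ℂ)) : QuadraticForm ℂ L :=
  QuadraticMap.linMulLin (LinearMap.proj 1 ∘ₗ e.toLinearMap) (LinearMap.proj 1 ∘ₗ e.toLinearMap) -
    QuadraticMap.linMulLin (LinearMap.proj 0 ∘ₗ e.toLinearMap) (LinearMap.proj 2 ∘ₗ e.toLinearMap)

theorem conic_apply (e : L ≃ₗ[ℂ] (Fin 3 → ℂ)) (w : L) :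
    conic e w = e w 1 * e w 1 - e w 0 * e w 2 := rfl

theorem polarBilin_conic (e : L ≃ₗ[ℂ] (Fin 3 → ℂ)) (v w : L) :
    QuadraticMap.polarBilin (conic e) v w =
      2 * e v 1 * e w 1 - e v 0 * e w 2 - e v 2 * e w 0 := by
  rw [QuadraticMap.polarBilin_apply_apply, QuadraticMap.polar]
  simp only [conic_apply, map_add, Pi.add_apply]
  ring

theorem polarBilin_conic_separatingLeft (e : L ≃ₗ[ℂ] (Fin 3 → ℂ)) :
    (QuadraticMap.polarBilin (conic e)).SeparatingLeft := by
  intro v hv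
  have h (y : Fin 3 → ℂ) := hv (e.symm y)
  simp only [polarBilin_conic, LinearEquiv.apply_symm_apply] at h
  have h0 := h ![1, 0, 0]
  have h1 := h ![0, 1, 0]
  have h2 := h ![0, 0, 1]
  simp at h0 h1 h2
  apply e.injective
  rw [map_zero]
  ext i
  fin_cases i
  -- The polar form is antidiagonal, so the third basis vector detects coordinate `0` and the first
  -- detects coordinate `2`.
  exacts [h2, h1, h0]

theorem polarBilin_conic_nondegenerate (e : L ≃ₗ[ℂ] (Fin 3 → ℂ)) :
    (QuadraticMap.polarBilin (conic e)).Nondegenerate := by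
  refine ⟨polarBilin_conic_separatingLeft e,
    fun w hw => polarBilin_conic_separatingLeft e w fun v => ?_⟩
  rw [← hw v, polarBilin_conic, polarBilin_conic]
  ring

theorem isSmoothConicIn_of_equiv (e : L ≃ₗ[ℂ] (Fin 3 → ℂ)) {S : Set (ℙ ℂ W)}
    (h : S = {p | p ∈ linearSubvariety L ∧
      ∀ w : L, (w : W) ∈ p.submodule → e w 1 * e w 1 - e w 0 * e w 2 = 0}) :
    IsSmoothConicIn S L :=
  ⟨by rw [e.finrank_eq, Module.finrank_fin_fun], conic e, polarBilin_conic_nondegenerate e, h⟩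

end Conic

/-! ### The case `a = b = 1`: coordinates, conic and transversality. -/

section DegreeOne

/-- The section `x_k` of `𝒪(1)`. -/
def coord (k : Fin 2) : H0 1 := ofPoly zero_le_one (X k) (isHomogeneous_X ℂ k)

theorem toPoly_coord (k : Fin 2) : toPoly 1 (coord k) = X k := toPoly_ofPoly _ _ _

/-- The coefficient of `x_k` in a section of `𝒪(1)`. -/
def coordCoeff (k : Fin 2) : Module.Dual ℂ (H0 1) :=
  lcoeff ℂ (Finsupp.single k 1) ∘ₗ toPoly 1

theorem coordCoeff_coord (k l : Fin 2) : coordCoeff k (coord l) = if l = k then 1 else 0 := by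
  change coeff (Finsupp.single k 1) (toPoly 1 (coord l)) = _
  rw [toPoly_coord, coeff_X]
  simp [Finsupp.single_left_inj]

theorem eq_sum_coord (s : H0 1) : s = coordCoeff 0 s • coord 0 + coordCoeff 1 s • coord 1 := by
  have h : toPoly 1 s ∈ grading 1 := toPoly_mem zero_le_one s
  rw [grading, homogeneousSubmodule_one_eq_span_X, Submodule.mem_span_range_iff_exists_fun] at h
  obtain ⟨c, hc⟩ := h
  have hs : s = c 0 • coord 0 + c 1 • coord 1 := by
    apply toPoly_injective
    rw [← hc]
    simp [toPoly_coord]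
  rw [hs]
  simp [coordCoeff_coord]

/-- The sections `(x_k, 0)` of `𝒪(1) ⊕ 𝒪(1)`. -/
def inlCoord (k : Fin 2) : H0E 1 1 := (coord k, 0)

/-- The sections `(0, x_k)` of `𝒪(1) ⊕ 𝒪(1)`. -/
def inrCoord (k : Fin 2) : H0E 1 1 := (0, coord k)

/-- The coordinate `(s₁, s₂) ↦ coefficient of x_k in s₁`. -/
def inlCoeff (k : Fin 2) : Module.Dual ℂ (H0E 1 1) := coordCoeff k ∘ₗ LinearMap.fst ℂ _ _

/-- The coordinate `(s₁, s₂) ↦ coefficient of x_k in s₂`. -/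
def inrCoeff (k : Fin 2) : Module.Dual ℂ (H0E 1 1) := coordCoeff k ∘ₗ LinearMap.snd ℂ _ _

@[simp]
theorem inlCoeff_inlCoord (k l : Fin 2) : inlCoeff k (inlCoord l) = if l = k then 1 else 0 :=
  coordCoeff_coord k l

@[simp]
theorem inlCoeff_inrCoord (k l : Fin 2) : inlCoeff k (inrCoord l) = 0 := map_zero (coordCoeff k)

@[simp]
theorem inrCoeff_inlCoord (k l : Fin 2) : inrCoeff k (inlCoord l) = 0 := map_zero (coordCoeff k)

@[simp]
theorem inrCoeff_inrCoord (k l : Fin 2) : inrCoeff k (inrCoord l) = if l = k then 1 else 0 :=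
  coordCoeff_coord k l

theorem eq_sum_inlCoord_inrCoord (s : H0E 1 1) :
    s = inlCoeff 0 s • inlCoord 0 + inlCoeff 1 s • inlCoord 1 + inrCoeff 0 s • inrCoord 0 +
      inrCoeff 1 s • inrCoord 1 := by
  refine Prod.ext ?_ ?_
  · simpa [inlCoord, inrCoord, inlCoeff] using eq_sum_coord s.1
  · simpa [inlCoord, inrCoord, inrCoeff] using eq_sum_coord s.2

theorem eq_sum_wedge (w : ⋀[ℂ]^2 (H0E 1 1)) :
    w = wedgeForm (inlCoeff 0) (inlCoeff 1) w • wedge (inlCoord 0) (inlCoord 1) +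
      wedgeForm (inlCoeff 0) (inrCoeff 0) w • wedge (inlCoord 0) (inrCoord 0) +
      wedgeForm (inlCoeff 0) (inrCoeff 1) w • wedge (inlCoord 0) (inrCoord 1) +
      wedgeForm (inlCoeff 1) (inrCoeff 0) w • wedge (inlCoord 1) (inrCoord 0) +
      wedgeForm (inlCoeff 1) (inrCoeff 1) w • wedge (inlCoord 1) (inrCoord 1) +
      wedgeForm (inrCoeff 0) (inrCoeff 1) w • wedge (inrCoord 0) (inrCoord 1) := by
  have h : LinearMap.id =
      (wedgeForm (inlCoeff 0) (inlCoeff 1)).smulRight (wedge (inlCoord 0) (inlCoord 1)) +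
      (wedgeForm (inlCoeff 0) (inrCoeff 0)).smulRight (wedge (inlCoord 0) (inrCoord 0)) +
      (wedgeForm (inlCoeff 0) (inrCoeff 1)).smulRight (wedge (inlCoord 0) (inrCoord 1)) +
      (wedgeForm (inlCoeff 1) (inrCoeff 0)).smulRight (wedge (inlCoord 1) (inrCoord 0)) +
      (wedgeForm (inlCoeff 1) (inrCoeff 1)).smulRight (wedge (inlCoord 1) (inrCoord 1)) +
      (wedgeForm (inrCoeff 0) (inrCoeff 1)).smulRight (wedge (inrCoord 0) (inrCoord 1)) := by
    refine linearMap_ext_wedge fun s t => ?_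
    simp only [LinearMap.id_apply, LinearMap.add_apply, LinearMap.smulRight_apply, wedgeForm_wedge]
    conv_lhs => rw [eq_sum_inlCoord_inrCoord s, eq_sum_inlCoord_inrCoord t]
    simp only [map_add, map_smul, LinearMap.add_apply, LinearMap.smul_apply, wedge_self,
      wedge_swap (inlCoord 0) (inlCoord 1), wedge_swap (inlCoord 0) (inrCoord _),
      wedge_swap (inlCoord 1) (inrCoord _), wedge_swap (inrCoord 0) (inrCoord 1)]
    module
  exact LinearMap.congr_fun h w

theorem toPoly_d₂ (w : ⋀[ℂ]^2 (H0E 1 1)) : toPoly (1 + 1) (d₂ 1 1 w) =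
    C (wedgeForm (inlCoeff 0) (inrCoeff 0) w) * X 0 ^ 2 +
      C (wedgeForm (inlCoeff 0) (inrCoeff 1) w + wedgeForm (inlCoeff 1) (inrCoeff 0) w) *
        (X 0 * X 1) +
      C (wedgeForm (inlCoeff 1) (inrCoeff 1) w) * X 1 ^ 2 := by
  conv_lhs => rw [eq_sum_wedge w]
  simp only [map_add, map_smul, toPoly_d₂_wedge, inlCoord, inrCoord, map_zero, toPoly_coord,
    smul_eq_C_mul]
  ring

theorem mem_Kperp_one_iff (w : ⋀[ℂ]^2 (H0E 1 1)) : w ∈ Kperp 1 1 ↔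
    wedgeForm (inlCoeff 0) (inrCoeff 0) w = 0 ∧
      wedgeForm (inlCoeff 1) (inrCoeff 0) w = -wedgeForm (inlCoeff 0) (inrCoeff 1) w ∧
      wedgeForm (inlCoeff 1) (inrCoeff 1) w = 0 := by
  rw [mem_Kperp_iff, toPoly_d₂]
  constructor
  · intro h
    -- A binary quadratic form is determined by its values at these three points.
    have h0 := congrArg (aeval ![(1 : ℂ), 0]) h
    have h1 := congrArg (aeval ![(0 : ℂ), 1]) h
    have h2 := congrArg (aeval ![(1 : ℂ), 1]) h
    simp at h0 h1 h2
    refine ⟨h0, ?_, h1⟩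
    linear_combination h2 - h0 - h1
  · rintro ⟨h0, h1, h2⟩
    rw [h0, h1, h2]
    simp

/-- The bivector `(α x₀, β x₀) ∧ (α x₁, β x₁)`. -/
def conicPoint (α β : ℂ) : ⋀[ℂ]^2 (H0E 1 1) :=
  wedge (α • inlCoord 0 + β • inrCoord 0) (α • inlCoord 1 + β • inrCoord 1)

theorem conicPoint_mem_Kperp (α β : ℂ) : conicPoint α β ∈ Kperp 1 1 := by
  rw [mem_Kperp_one_iff, conicPoint]
  simp only [wedgeForm_wedge]
  simp [mul_comm]

/-- The linear coordinates on `K^⊥`. -/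
def kperpCoord : Kperp 1 1 →ₗ[ℂ] Fin 3 → ℂ :=
  LinearMap.pi ![wedgeForm (inlCoeff 0) (inlCoeff 1), wedgeForm (inlCoeff 0) (inrCoeff 1),
    wedgeForm (inrCoeff 0) (inrCoeff 1)] ∘ₗ (Kperp 1 1).subtype

/-- The element of `K^⊥` with given coordinates. -/
def kperpVec (y₀ y₁ y₂ : ℂ) : ⋀[ℂ]^2 (H0E 1 1) :=
  y₀ • wedge (inlCoord 0) (inlCoord 1) +
    y₁ • (wedge (inlCoord 0) (inrCoord 1) - wedge (inlCoord 1) (inrCoord 0)) +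
    y₂ • wedge (inrCoord 0) (inrCoord 1)

theorem kperpVec_mem (y₀ y₁ y₂ : ℂ) : kperpVec y₀ y₁ y₂ ∈ Kperp 1 1 := by
  rw [mem_Kperp_one_iff, kperpVec]
  simp

theorem kperpCoord_kperpVec (y₀ y₁ y₂ : ℂ) :
    kperpCoord ⟨kperpVec y₀ y₁ y₂, kperpVec_mem y₀ y₁ y₂⟩ = ![y₀, y₁, y₂] := by
  ext i
  fin_cases i <;> simp [kperpCoord, kperpVec]

theorem eq_kperpVec (w : Kperp 1 1) :
    (w : ⋀[ℂ]^2 (H0E 1 1)) = kperpVec (kperpCoord w 0) (kperpCoord w 1) (kperpCoord w 2) := by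
  obtain ⟨h0, h1, h2⟩ := (mem_Kperp_one_iff _).1 w.2
  conv_lhs => rw [eq_sum_wedge (w : ⋀[ℂ]^2 (H0E 1 1)), h0, h1, h2]
  simp only [kperpVec, kperpCoord, LinearMap.comp_apply, LinearMap.pi_apply,
    Submodule.subtype_apply, Matrix.cons_val]
  module

/-- The coordinates identify `K^⊥` with `ℂ³`. -/
def kperpEquiv : Kperp 1 1 ≃ₗ[ℂ] (Fin 3 → ℂ) :=
  LinearEquiv.ofBijective kperpCoord
    ⟨fun v w h => Subtype.ext (by rw [eq_kperpVec v, eq_kperpVec w, h]), fun y =>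
      ⟨⟨kperpVec (y 0) (y 1) (y 2), kperpVec_mem _ _ _⟩, by
        rw [kperpCoord_kperpVec]
        ext i
        fin_cases i <;> rfl⟩⟩

/-- The Veronese parametrization of `y₁² = y₀ y₂`. -/
theorem conicPoint_eq_kperpVec (α β : ℂ) :
    conicPoint α β = kperpVec (α ^ 2) (α * β) (β ^ 2) := by
  simp only [conicPoint, kperpVec, map_add, map_smul, LinearMap.add_apply, LinearMap.smul_apply,
    wedge_swap (inlCoord 1) (inrCoord 0)]
  module

theorem kperpCoord_mul_eq_iff (w : Kperp 1 1) :
    kperpCoord w 1 * kperpCoord w 1 - kperpCoord w 0 * kperpCoord w 2 = 0 ↔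
      ∃ α β : ℂ, (w : ⋀[ℂ]^2 (H0E 1 1)) = conicPoint α β := by
  constructor
  · intro h
    -- Take `α² = y₀`. If `α ≠ 0`, then `β = y₁ / α`; otherwise `y₁ = 0` and `β` is a square root of
    -- `y₂`.
    obtain ⟨α, hα⟩ := IsAlgClosed.exists_pow_nat_eq (kperpCoord w 0) two_pos
    by_cases h0 : α = 0
    · obtain ⟨β, hβ⟩ := IsAlgClosed.exists_pow_nat_eq (kperpCoord w 2) two_pos
      refine ⟨0, β, ?_⟩
      have h1 : kperpCoord w 1 = 0 := by
        rw [← hα, h0] at h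
        simpa using h
      rw [eq_kperpVec w, conicPoint_eq_kperpVec, ← hα, ← hβ, h1, h0, zero_mul]
    · refine ⟨α, kperpCoord w 1 / α, ?_⟩
      have h2 : (kperpCoord w 1 / α) ^ 2 = kperpCoord w 2 := by
        rw [div_pow, div_eq_iff (pow_ne_zero 2 h0), hα]
        linear_combination h
      rw [conicPoint_eq_kperpVec, h2, mul_div_cancel₀ _ h0, hα, ← eq_kperpVec]
  · rintro ⟨α, β, h⟩
    have hw : w = ⟨kperpVec (α ^ 2) (α * β) (β ^ 2), kperpVec_mem _ _ _⟩ :=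
      Subtype.ext (h.trans (conicPoint_eq_kperpVec α β))
    rw [hw, kperpCoord_kperpVec]
    simp
    ring

/-- The equations of `K^⊥` kill the middle product of the Plücker relation and turn the last into
`-y₁²`. -/
theorem kperpCoord_mul_eq_of_mem_gr₂ {p : ℙ ℂ (⋀[ℂ]^2 (H0E 1 1))} (hp : p ∈ gr₂ (H0E 1 1))
    (w : Kperp 1 1) (hw : (w : ⋀[ℂ]^2 (H0E 1 1)) ∈ p.submodule) :
    kperpCoord w 1 * kperpCoord w 1 - kperpCoord w 0 * kperpCoord w 2 = 0 := by
  obtain ⟨s, t, hst⟩ := exists_eq_wedge_of_mem_gr₂ hp hw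
  obtain ⟨h0, h1, h2⟩ := (mem_Kperp_one_iff _).1 w.2
  have h := plucker_relation (inrCoeff 0) (inrCoeff 1) (inlCoeff 0) (inlCoeff 1) s t
  rw [← hst, h0, h1, h2] at h
  change wedgeForm (inlCoeff 0) (inrCoeff 1) w * wedgeForm (inlCoeff 0) (inrCoeff 1) w -
    wedgeForm (inlCoeff 0) (inlCoeff 1) w * wedgeForm (inrCoeff 0) (inrCoeff 1) w = 0
  linear_combination -h

theorem GE_one_one_eq : GE 1 1 = {p | p ∈ linearSubvariety (Kperp 1 1) ∧
    ∀ w : Kperp 1 1, (w : ⋀[ℂ]^2 (H0E 1 1)) ∈ p.submodule →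
      kperpCoord w 1 * kperpCoord w 1 - kperpCoord w 0 * kperpCoord w 2 = 0} := by
  ext p
  refine ⟨fun hp => ⟨hp.2, kperpCoord_mul_eq_of_mem_gr₂ hp.1⟩, fun ⟨hp, h⟩ => ⟨?_, hp⟩⟩
  have hrep := rep_mem_submodule p
  obtain ⟨α, β, hαβ⟩ := (kperpCoord_mul_eq_iff _).1 (h ⟨p.rep, hp hrep⟩ hrep)
  have hαβ' : p.rep = conicPoint α β := hαβ
  have h0 := p.rep_nonzero
  refine ⟨_, _, linearIndependent_of_wedge_ne_zero (hαβ' ▸ h0), ?_⟩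
  rw [p.submodule_eq, hαβ']
  rfl

theorem isSmoothConicIn_GE_one_one : IsSmoothConicIn (GE 1 1) (Kperp 1 1) :=
  isSmoothConicIn_of_equiv kperpEquiv GE_one_one_eq

/-- At a point of `𝔾(E)`, the differential of `d₂` on the tangent space of the Grassmannian is
surjective. -/
theorem exists_tangent_sub_mem_Kperp {α β : ℂ} (h : α ≠ 0 ∨ β ≠ 0) (w : ⋀[ℂ]^2 (H0E 1 1)) :
    ∃ u v : H0E 1 1, w - (wedge (α • inlCoord 0 + β • inrCoord 0) u +
      wedge (α • inlCoord 1 + β • inrCoord 1) v) ∈ Kperp 1 1 := by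
  -- With this normalization, `u = (γ ℓ, δ ℓ)` satisfies `α u₂ - β u₁ = ℓ`, so `d₂(σ_k ∧ u) = x_k
  -- ℓ`.
  obtain ⟨γ, δ, hγδ⟩ : ∃ γ δ : ℂ, α * δ - β * γ = 1 := by
    rcases h with h | h
    · exact ⟨0, α⁻¹, by simp [h]⟩
    · exact ⟨-β⁻¹, 0, by simp [h]⟩
  let l (c d : ℂ) : H0E 1 1 := γ • (c • inlCoord 0 + d • inlCoord 1) +
    δ • (c • inrCoord 0 + d • inrCoord 1)
  -- The linear forms are read off by writing `d₂ w` as `x₀ ℓ₀ + x₁ ℓ₁`.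
  refine ⟨l (wedgeForm (inlCoeff 0) (inrCoeff 0) w) (wedgeForm (inlCoeff 0) (inrCoeff 1) w),
    l (wedgeForm (inlCoeff 1) (inrCoeff 0) w) (wedgeForm (inlCoeff 1) (inrCoeff 1) w), ?_⟩
  rw [mem_Kperp_one_iff]
  simp only [map_sub, map_add, l, map_smul]
  simp
  refine ⟨?_, ?_, ?_⟩
  · linear_combination (-wedgeForm (inlCoeff 0) (inrCoeff 0) w) * hγδ
  · linear_combination
      (-wedgeForm (inlCoeff 1) (inrCoeff 0) w - wedgeForm (inlCoeff 0) (inrCoeff 1) w) * hγδ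
  · linear_combination (-wedgeForm (inlCoeff 1) (inrCoeff 1) w) * hγδ

theorem intersectTransversely_one_one :
    IntersectTransversely (gr₂ (H0E 1 1)) (linearSubvariety (Kperp 1 1)) := by
  rintro p ⟨hp, hpK⟩
  have hrep := rep_mem_submodule p
  obtain ⟨α, β, hαβ⟩ := (kperpCoord_mul_eq_iff ⟨p.rep, hpK hrep⟩).1
    (kperpCoord_mul_eq_of_mem_gr₂ hp _ hrep)
  have hαβ' : p.rep = conicPoint α β := hαβ
  have h0 : conicPoint α β ≠ 0 := hαβ' ▸ p.rep_nonzero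
  have hne : α ≠ 0 ∨ β ≠ 0 := by
    by_contra! h
    apply h0
    simp [conicPoint, h.1, h.2]
  rw [tangentSpace_sup_eq_top_iff, hαβ', eq_top_iff]
  intro w _
  obtain ⟨u, v, huv⟩ := exists_tangent_sub_mem_Kperp hne w
  refine Submodule.mem_sup_right ?_
  rw [← add_sub_cancel (wedge (α • inlCoord 0 + β • inrCoord 0) u +
      wedge (α • inlCoord 1 + β • inrCoord 1) v) w]
  refine Submodule.add_mem_sup (Submodule.add_mem _ ?_ ?_) ?_
  · exact wedge_mem_coneTangentSpace_gr₂ h0 u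
  · exact wedge_mem_coneTangentSpace_gr₂' h0 v
  · exact le_coneTangentSpace_linearSubvariety (conicPoint_mem_Kperp α β) h0 huv

end DegreeOne

end P1Bundle

end

theorem mainTheorem10 (a b : ℤ) (ha : 1 ≤ a) (hb : 1 ≤ b) :
    (P1Bundle.IntersectTransversely (P1Bundle.gr₂ (P1Bundle.H0E a b))
        (P1Bundle.linearSubvariety (P1Bundle.Kperp a b)) ↔ a = 1 ∧ b = 1) ∧
    (a = 1 ∧ b = 1 → P1Bundle.IsSmoothConicIn (P1Bundle.GE a b) (P1Bundle.Kperp a b)) := by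
  refine ⟨⟨fun h => ?_, ?_⟩, ?_⟩
  · by_contra hab
    by_cases ha' : a = 1
    · exact P1Bundle.not_intersectTransversely_of_right ha (by omega) h
    · exact P1Bundle.not_intersectTransversely_of_left (by omega) hb h
  · rintro ⟨rfl, rfl⟩
    exact P1Bundle.intersectTransversely_one_one
  · rintro ⟨rfl, rfl⟩
    exact P1Bundle.isSmoothConicIn_GE_one_one
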